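/- Call a division ring centrally finite if it is a finite-dimensional vector space over its center, and call a division ring $D$ weakly locally finite if for every finite subset $S\subseteq D$ the division subring of $D$ generated by $S$ is centrally finite (i.e. finite-dimensional over its own center). Let $D$ be a weakly locally finite division ring with center $F$, let $K\subsetneq D$ be a proper division subring, and let $N$ be a normal subgroup of the multiplicative group $D^*$. Suppose that $N$ is radical over $K$, i.e. for every $x\in N$ there is an integer $n\ge 1$, depending on $x$, such that $x^{n}\in K$. Then $N\subseteq F$. -/

import Mathlib

/-- A division ring is centrally finite if it is a finite-dimensional vector space over its
center. -/
def IsCentrallyFinite (D : Type*) [DivisionRing D] : Prop :=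
  FiniteDimensional (Subring.center D) D

/-- A division ring `D` is weakly locally finite if for every finite subset `S` of `D` the
division subring of `D` generated by `S` is centrally finite (that is, finite-dimensional over its
own center). Mathlib's `Subfield D` is the type of division subrings of a division ring `D`. -/
def IsWeaklyLocallyFinite (D : Type*) [DivisionRing D] : Prop :=
  ∀ S : Set D, S.Finite → IsCentrallyFinite (Subfield.closure S)

/-- An element `x` of a division ring `D` is radical over the division subring `K` if some
positive power of `x` lies in `K`. -/
def IsRadicalOver {D : Type*} [DivisionRing D] (K : Subfield D) (x : D) : Prop :=
  ∃ n : ℕ, 0 < n ∧ x ^ n ∈ K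

/-! Commuting with y can be tested in the division subring generated by x, y and some a ∉ K, so D
may be taken finite-dimensional over its center F. Comparing conjugates by a and a + 1
(`exists_pow_commute_of_notMem`) then makes a power of each element of N central. Commutators in N
have norm 1, hence are torsion (`commutator_pow_eq_one`). If F is algebraic over a finite field,
Wedderburn's theorem makes D commutative. Otherwise F has a nontrivial valuation ring, and a deep
enough congruence subgroup over it is torsion-free (`IsCongruentOne.eq_one_of_pow`). For suitable s
≠ 0 the commutator of x with 1 + s • y lies there, so it is 1 and x commutes with y. -/

/-- The elements of a finite-dimensional division algebra whose left multiplication matrix is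
integral and congruent to `1` modulo `θ`. -/
def IsCongruentOne (O : Type*) {F D ι : Type*} [CommRing O] [Field F] [Algebra O F]
    [DivisionRing D] [Algebra F D] [Fintype ι] [DecidableEq ι] (b : Module.Basis ι F D)
    (θ : O) (c : D) : Prop :=
  ∃ Z : Matrix ι ι O, Algebra.leftMulMatrix b c = (algebraMap O F).mapMatrix (1 + θ • Z)

/-! ### Congruence subgroups over a local domain -/

section Congruence

variable {O F D ι : Type*} [CommRing O] [Field F] [Algebra O F]
  [DivisionRing D] [Algebra F D] [Fintype ι] [DecidableEq ι] {b : Module.Basis ι F D} {θ : O}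

theorem IsCongruentOne.one : IsCongruentOne O b θ (1 : D) :=
  ⟨0, by simp⟩

theorem IsCongruentOne.mul {c d : D} (hc : IsCongruentOne O b θ c) (hd : IsCongruentOne O b θ d) :
    IsCongruentOne O b θ (c * d) := by
  obtain ⟨Z, hZ⟩ := hc
  obtain ⟨W, hW⟩ := hd
  refine ⟨Z + W + θ • (Z * W), ?_⟩
  rw [map_mul, hZ, hW, ← map_mul]
  congr 1
  simp only [mul_add, add_mul, one_mul, mul_one, smul_add, smul_mul_assoc, mul_smul_comm]
  abel

theorem IsCongruentOne.pow {c : D} (hc : IsCongruentOne O b θ c) (n : ℕ) :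
    IsCongruentOne O b θ (c ^ n) := by
  induction n with
  | zero => simpa using IsCongruentOne.one
  | succ n ih => rw [pow_succ]; exact ih.mul hc

theorem isUnit_one_add_smul [IsLocalRing O] (hθ : θ ∈ IsLocalRing.maximalIdeal O)
    (Z : Matrix ι ι O) : IsUnit (1 + θ • Z) := by
  rw [Matrix.isUnit_iff_isUnit_det, ← IsLocalRing.residue_ne_zero_iff_isUnit, RingHom.map_det,
    map_add, map_one]
  have : (IsLocalRing.residue O).mapMatrix (θ • Z) = 0 := by
    ext i j
    simp [(IsLocalRing.residue_eq_zero_iff θ).2 hθ]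
  simp [this]

theorem IsCongruentOne.inv [IsLocalRing O] (hθ : θ ∈ IsLocalRing.maximalIdeal O) {c : D}
    (hc : IsCongruentOne O b θ c) : IsCongruentOne O b θ c⁻¹ := by
  obtain ⟨Z, hZ⟩ := hc
  obtain ⟨V, hV⟩ := isUnit_one_add_smul hθ Z
  have hV' : (V⁻¹).val = 1 + θ • (-(Z * (V⁻¹).val)) := by
    have h : V.val * (V⁻¹).val = 1 := V.mul_inv
    rw [hV, add_mul, one_mul, smul_mul_assoc] at h
    rw [smul_neg, ← sub_eq_add_neg, eq_sub_iff_add_eq, h]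
  have hc0 : c ≠ 0 := by
    rintro rfl
    rw [map_zero, ← hV] at hZ
    have : Nonempty ι := b.index_nonempty
    exact (V.isUnit.map (algebraMap O F).mapMatrix).ne_zero hZ.symm
  refine ⟨_, Eq.trans ?_ (congrArg _ hV')⟩
  have h1 : Algebra.leftMulMatrix b c⁻¹ * (algebraMap O F).mapMatrix V.val = 1 := by
    rw [hV, ← hZ, ← map_mul, inv_mul_cancel₀ hc0, map_one]
  have h2 : (algebraMap O F).mapMatrix V.val * (algebraMap O F).mapMatrix (V⁻¹).val = 1 := by
    rw [← map_mul, V.mul_inv, map_one]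
  exact left_inv_eq_right_inv h1 h2

/-- Up to a prime number that vanishes in the field, every prime number divides `θ` with a
quotient in the maximal ideal. -/
def IsDeep (F : Type*) {O : Type*} [CommRing O] [IsLocalRing O] [Field F] (θ : O) : Prop :=
  ∀ l : ℕ, l.Prime → (l : F) = 0 ∨ ∃ m ∈ IsLocalRing.maximalIdeal O, θ = l * m

variable [IsLocalRing O] [IsDomain O] [IsFractionRing O F]

/-- In characteristic l, Frobenius gives (c - 1) ^ l = 0. Otherwise c ≠ 1 kills the geometric sum of
c; a diagonal entry of it is l * (1 + m * w), which would put 1 in the maximal ideal. -/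
theorem IsCongruentOne.eq_one_of_pow_prime (hθ : IsDeep F θ) {c : D}
    (hc : IsCongruentOne O b θ c) {l : ℕ} (hl : l.Prime) (h : c ^ l = 1) : c = 1 := by
  by_contra hne
  obtain h0 | ⟨m, hm, rfl⟩ := hθ l hl
  · have : Fact l.Prime := ⟨hl⟩
    have : CharP F l := by
      rw [CharP.charP_iff_prime_eq_zero hl]; exact h0
    have : CharP D l := charP_of_injective_algebraMap (algebraMap F D).injective l
    have := sub_pow_char_of_commute (p := l) (Commute.one_right c)
    rw [h, one_pow, sub_self] at this
    exact hne (sub_eq_zero.1 (pow_eq_zero_iff hl.ne_zero |>.1 this))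
  have hinj : Function.Injective ((algebraMap O F).mapMatrix (m := ι)) :=
    Matrix.map_injective (IsFractionRing.injective O F)
  by_cases hl0 : (l : O) = 0
  · obtain ⟨Z, hZ⟩ := hc
    rw [hl0, zero_mul, zero_smul, add_zero, map_one, ← map_one (Algebra.leftMulMatrix b)] at hZ
    exact hne (Algebra.leftMulMatrix_injective b hZ)
  choose W hW using fun n ↦ hc.pow n
  have hsum : ∑ i ∈ Finset.range l, c ^ i = 0 := by
    have := geom_sum_mul c l
    rw [h, sub_self] at this
    exact (mul_eq_zero.1 this).resolve_right (sub_ne_zero.2 hne)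
  have h1 : ∑ i ∈ Finset.range l, (1 + ((l : O) * m) • W i) = 0 := by
    apply hinj
    rw [map_sum, map_zero, ← map_zero (Algebra.leftMulMatrix b), ← hsum, map_sum]
    exact Finset.sum_congr rfl fun i _ ↦ (hW i).symm
  obtain ⟨i⟩ : Nonempty ι := b.index_nonempty
  have h2 := congrFun (congrFun h1 i) i
  rw [Finset.sum_add_distrib, ← Finset.smul_sum, Finset.sum_const, Finset.card_range,
    Matrix.add_apply, Matrix.smul_apply, Matrix.smul_apply, Matrix.one_apply_eq, nsmul_eq_mul,
    smul_eq_mul, Matrix.zero_apply, mul_assoc, ← mul_add] at h2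
  have h3 := (mul_eq_zero.1 h2).resolve_left hl0
  refine (Ideal.ne_top_iff_one _).1 (IsLocalRing.maximalIdeal.isMaximal O).ne_top ?_
  rw [eq_neg_of_add_eq_zero_left h3]
  exact neg_mem (Ideal.mul_mem_right _ _ hm)

theorem IsCongruentOne.eq_one_of_pow (hθ : IsDeep F θ) {c : D} (n : ℕ) (hn : 0 < n)
    (hc : IsCongruentOne O b θ c) (h : c ^ n = 1) : c = 1 := by
  induction n using Nat.strong_induction_on with
  | _ n ih =>
    by_cases hn1 : n = 1
    · simpa [hn1] using h
    obtain ⟨l, hl, k, rfl⟩ := Nat.exists_prime_and_dvd hn1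
    have hk : 0 < k := Nat.pos_of_mul_pos_left hn
    refine ih k (lt_mul_left hk hl.one_lt) hk ((hc.pow k).eq_one_of_pow_prime hθ hl ?_)
    rw [← pow_mul, mul_comm, h]

/-- If the commutators with `x` of all nonzero elements of `D` are torsion, then `x` is central. -/
theorem commute_of_isDeep (b : Module.Basis ι F D) (hm : θ ∈ IsLocalRing.maximalIdeal O)
    (h0 : θ ≠ 0) (hθ : IsDeep F θ) {x : D} (hx : x ≠ 0)
    (htor : ∀ y : D, y ≠ 0 → ∃ n, 0 < n ∧ (x * y * x⁻¹ * y⁻¹) ^ n = 1) (y : D) :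
    Commute x y := by
  let Y := Algebra.leftMulMatrix b y
  let Y' := Algebra.leftMulMatrix b (x * y * x⁻¹)
  -- r is a common denominator for the matrices of y and of its conjugate by x.
  obtain ⟨⟨r, hr⟩, hrY⟩ := IsLocalization.exist_integer_multiples_of_finite
    (nonZeroDivisors O) (S := F) (fun p : Bool × ι × ι ↦ (cond p.1 Y Y') p.2.1 p.2.2)
  choose R hR using hrY
  have hr0 : r ≠ 0 := nonZeroDivisors.ne_zero hr
  let s : F := algebraMap O F (θ * r)
  have hs : s ≠ 0 := by
    simpa [s] using ⟨h0, hr0⟩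
  have key (z : D) (B : Bool) (hz : Algebra.leftMulMatrix b z = cond B Y Y') :
      IsCongruentOne O b θ (1 + s • z) := by
    refine ⟨Matrix.of fun i j ↦ R (B, i, j), ?_⟩
    rw [map_add, map_one, map_smul, hz, map_add, map_one]
    congr 1
    ext i j
    have := hR (B, i, j)
    simp only [Algebra.smul_def] at this
    simp only [RingHom.mapMatrix_apply, Matrix.map_apply, Matrix.smul_apply, Matrix.of_apply,
      smul_eq_mul, map_mul, this, s, mul_assoc]
  have hv := key y true rfl
  have hu := key (x * y * x⁻¹) false rfl
  have hu' : x * (1 + s • y) * x⁻¹ = 1 + s • (x * y * x⁻¹) := by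
    rw [mul_add, add_mul, mul_one, mul_inv_cancel₀ hx, mul_smul_comm, smul_mul_assoc]
  have hv0 : 1 + s • y ≠ 0 := by
    intro h0
    obtain ⟨Z, hZ⟩ := hv
    rw [h0, map_zero] at hZ
    have : Nonempty ι := b.index_nonempty
    exact ((isUnit_one_add_smul hm Z).map (algebraMap O F).mapMatrix).ne_zero hZ.symm
  obtain ⟨n, hn, hpow⟩ := htor _ hv0
  rw [hu'] at hpow
  have h1 := (hu.mul (hv.inv hm)).eq_one_of_pow hθ n hn hpow
  have h2 := (mul_inv_eq_one₀ hv0).1 h1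
  have h3 : x * y * x⁻¹ = y := smul_right_injective D hs (add_left_cancel h2)
  exact (mul_inv_eq_iff_eq_mul₀ hx).1 h3

end Congruence
-- Valuation rings, algebraic extensions of finite fields, and norms
section Field

variable {F : Type*} [Field F]

/-- The integral closure of the prime ring is the intersection of all valuation rings of F. -/
theorem exists_valuationSubring_ne_top {u : F} (hu : ¬ IsIntegral ℤ u) :
    ∃ O : ValuationSubring F, u ∉ O := by
  by_contra! h
  have h1 : u ∈ (⨅ V : {V : ValuationSubring F // (∅ : Set F) ⊆ V.toSubring}, V.1.toSubring) := by
    simp only [Subring.mem_iInf]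
    exact fun V ↦ h V.1
  rw [iInf_valuationSubring_superset, Subring.closure_empty] at h1
  have h2 : IsIntegral (⊥ : Subring F) u := h1
  have hsurj : Function.Surjective (Int.castRingHom (⊥ : Subring F)) := by
    rintro ⟨z, hz⟩
    obtain ⟨n, rfl⟩ := Subring.mem_bot.1 hz
    exact ⟨n, by ext; simp⟩
  apply hu
  obtain ⟨p, hp, hpu⟩ := h2
  obtain ⟨q, hq, -, hqm⟩ := Polynomial.lifts_and_natDegree_eq_and_monic
    (Polynomial.map_surjective _ hsurj p) hp
  refine ⟨q, hqm, ?_⟩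
  rw [← hq, Polynomial.eval₂_map] at hpu
  rwa [RingHom.ext_int (algebraMap ℤ F) ((algebraMap (⊥ : Subring F) F).comp (Int.castRingHom _))]

/-- If a prime p ≠ 0 in F is a nonunit of O, all other primes are units and θ = p * p works.
Otherwise every prime nonzero in F is a unit and θ = u⁻¹ works. -/
theorem ValuationSubring.exists_isDeep (O : ValuationSubring F) {u : F} (hu : u ∉ O) :
    ∃ θ ∈ IsLocalRing.maximalIdeal O, θ ≠ 0 ∧ IsDeep F θ := by
  by_cases h : ∃ p : ℕ, p.Prime ∧ (p : F) ≠ 0 ∧ (p : O) ∈ IsLocalRing.maximalIdeal O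
  · obtain ⟨p, hp, hp0, hpm⟩ := h
    have hp0' : (p : O) ≠ 0 := fun h ↦ hp0 (by simpa using congrArg (algebraMap O F) h)
    refine ⟨p * p, Ideal.mul_mem_left _ _ hpm, mul_ne_zero hp0' hp0', fun l hl ↦ Or.inr ?_⟩
    by_cases hlp : l = p
    · exact ⟨p, hpm, by rw [hlp]⟩
    have hlu : IsUnit (l : O) := by
      by_contra hlm
      have hlm' : (l : O) ∈ IsLocalRing.maximalIdeal O := hlm
      have hcop : IsCoprime (l : ℤ) p := Nat.isCoprime_iff_coprime.2
        ((Nat.coprime_primes hl hp).2 hlp)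
      obtain ⟨s, t, hst⟩ := hcop
      refine (Ideal.ne_top_iff_one _).1 (IsLocalRing.maximalIdeal.isMaximal O).ne_top ?_
      have : (s : O) * l + t * p = 1 := by exact_mod_cast congrArg (Int.cast : ℤ → O) hst
      rw [← this]
      exact Ideal.add_mem _ (Ideal.mul_mem_left _ _ hlm') (Ideal.mul_mem_left _ _ hpm)
    obtain ⟨w, hw⟩ := hlu
    refine ⟨w⁻¹ * (p * p), Ideal.mul_mem_left _ _ (Ideal.mul_mem_left _ _ hpm), ?_⟩
    rw [← hw, Units.mul_inv_cancel_left]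
  · push Not at h
    have hu' : u⁻¹ ∈ O := (O.mem_or_inv_mem u).resolve_left hu
    have hu0 : u ≠ 0 := fun h ↦ hu (h ▸ O.zero_mem)
    have hm : (⟨u⁻¹, hu'⟩ : O) ∈ IsLocalRing.maximalIdeal O := by
      rintro ⟨w, hw⟩
      apply hu
      have h1 : (w : O).val * (w⁻¹ : Oˣ).val.val = 1 := by
        exact_mod_cast congrArg Subtype.val w.mul_inv
      rw [hw] at h1
      have : u = (w⁻¹ : Oˣ).val.val := by
        field_simp at h1
        exact h1.symm
      rw [this]
      exact Subtype.property _
    refine ⟨⟨u⁻¹, hu'⟩, hm, fun h ↦ inv_ne_zero hu0 (congrArg Subtype.val h), fun l hl ↦ ?_⟩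
    by_cases hl0 : (l : F) = 0
    · exact Or.inl hl0
    have hlu : IsUnit (l : O) := not_not.1 (h l hl hl0)
    obtain ⟨w, hw⟩ := hlu
    refine Or.inr ⟨w⁻¹ * ⟨u⁻¹, hu'⟩, Ideal.mul_mem_left _ _ hm, ?_⟩
    rw [← hw, Units.mul_inv_cancel_left]

theorem Algebra.IsIntegral.exists_charP_prime [Algebra.IsIntegral ℤ F] :
    ∃ p : ℕ, p.Prime ∧ CharP F p := by
  obtain ⟨p, hp⟩ := CharP.exists F
  obtain h | rfl := CharP.char_is_prime_or_zero F p
  · exact ⟨p, h, hp⟩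
  have : CharZero F := CharP.charP_to_charZero F
  have := isField_of_isIntegral_of_isField (R := ℤ) (S := F) (algebraMap ℤ F).injective_int
    (Field.toIsField F)
  exact absurd this Int.not_isField

theorem Algebra.IsIntegral.finite_adjoin [Algebra.IsIntegral ℤ F] {S : Set F} (hS : S.Finite) :
    Finite (Algebra.adjoin ℤ S) := by
  obtain ⟨p, hp, hpF⟩ := Algebra.IsIntegral.exists_charP_prime (F := F)
  have : Fact p.Prime := ⟨hp⟩
  have h1 : (Algebra.adjoin ℤ S).toSubmodule.FG :=
    fg_adjoin_of_finite hS fun x _ ↦ Algebra.IsIntegral.isIntegral x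
  have : Module.Finite ℤ (Algebra.adjoin ℤ S) := Module.Finite.iff_fg.2 h1
  have : CharP (Algebra.adjoin ℤ S) p :=
    (RingHom.charP_iff (Algebra.adjoin ℤ S).val.toRingHom Subtype.val_injective p).2 hpF
  let := ZMod.algebra (Algebra.adjoin ℤ S) p
  have : Module.Finite (ZMod p) (Algebra.adjoin ℤ S) := .of_restrictScalars_finite ℤ _ _
  exact Module.finite_of_finite (ZMod p)

variable {D : Type*} [DivisionRing D] [Algebra F D]

/-- A finite-dimensional division algebra over an algebraic extension of a finite field is
commutative. -/
theorem commute_of_isIntegral_int [FiniteDimensional F D] [Algebra.IsIntegral ℤ F] (x y : D) :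
    Commute x y := by
  classical
  let b := Module.finBasis F D
  let L := Algebra.leftMulMatrix b
  let E : Set F := Set.range (fun p : Bool × Fin (Module.finrank F D) × Fin (Module.finrank F D) ↦
    (cond p.1 (L x) (L y)) p.2.1 p.2.2)
  have : Finite (Algebra.adjoin ℤ E) := Algebra.IsIntegral.finite_adjoin (Set.finite_range _)
  let A := (Algebra.adjoin ℤ E).toSubring
  have : Finite A := this
  -- T embeds in the matrices over the finite ring A, so it is a finite domain, and Wedderburn's
  -- little theorem applies.
  let T : Subring D := (A.matrix).comap L.toRingHom
  have hmem (B : Bool) (z : D) (hz : L z = cond B (L x) (L y)) : z ∈ T := by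
    intro i j
    exact Algebra.subset_adjoin ⟨(B, i, j), by simp [← hz]⟩
  have : Finite T := by
    refine Finite.of_injective (β := Matrix (Fin (Module.finrank F D)) (Fin (Module.finrank F D)) A)
      (fun z ↦ Matrix.of fun i j ↦ ⟨L z.1 i j, z.2 i j⟩) fun z w h ↦ ?_
    apply Subtype.ext
    apply Algebra.leftMulMatrix_injective b
    ext i j
    exact congrArg Subtype.val (congrFun (congrFun h i) j)
  have := (Finite.isDomain_to_isField T).mul_comm ⟨x, hmem true x rfl⟩ ⟨y, hmem false y rfl⟩
  exact congrArg Subtype.val this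

theorem commute_of_commutators_torsion [FiniteDimensional F D] {x : D} (hx : x ≠ 0)
    (htor : ∀ y : D, y ≠ 0 → ∃ n, 0 < n ∧ (x * y * x⁻¹ * y⁻¹) ^ n = 1) (y : D) :
    Commute x y := by
  by_cases h : Algebra.IsIntegral ℤ F
  · exact commute_of_isIntegral_int (F := F) x y
  · rw [Algebra.isIntegral_def] at h
    push Not at h
    obtain ⟨u, hu⟩ := h
    obtain ⟨O, hO⟩ := exists_valuationSubring_ne_top hu
    obtain ⟨θ, hm, h0, hθ⟩ := O.exists_isDeep hO
    exact commute_of_isDeep (Module.finBasis F D) hm h0 hθ hx htor y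

/-- A commutator that is radical over the base field is torsion. -/
theorem commutator_pow_eq_one [FiniteDimensional F D] {x y : D} (hx : x ≠ 0) (hy : y ≠ 0) {n : ℕ}
    (hn : 0 < n) {f : F} (h : (x * y * x⁻¹ * y⁻¹) ^ n = algebraMap F D f) :
    ∃ m, 0 < m ∧ (x * y * x⁻¹ * y⁻¹) ^ m = 1 := by
  refine ⟨n * Module.finrank F D, Nat.mul_pos hn Module.finrank_pos, ?_⟩
  have hN : Algebra.norm F (x * y * x⁻¹ * y⁻¹) = 1 := by
    have h1 : Algebra.norm F x * Algebra.norm F x⁻¹ = 1 := by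
      rw [← map_mul, mul_inv_cancel₀ hx, map_one]
    have h2 : Algebra.norm F y * Algebra.norm F y⁻¹ = 1 := by
      rw [← map_mul, mul_inv_cancel₀ hy, map_one]
    rw [map_mul, map_mul, map_mul]
    linear_combination Algebra.norm F y * Algebra.norm F y⁻¹ * h1 + h2
  have hf : f ^ Module.finrank F D = 1 := by
    have h1 := Algebra.norm_algebraMap_of_basis (Module.finBasis F D) f
    rwa [← h, map_pow, hN, one_pow, Fintype.card_fin, eq_comm] at h1
  rw [pow_mul, h, ← map_pow, hf, map_one]

end Field
-- Normal subgroups radical over a proper division subring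
section Radical

variable {D : Type*} [DivisionRing D] {K : Subfield D} {N : Subgroup Dˣ}

theorem IsRadicalOver.exists_common {x y z : D} (hx : IsRadicalOver K x) {n : ℕ}
    (hn : 0 < n) (hy : y ^ n ∈ K) {m : ℕ} (hm : 0 < m) (hz : z ^ m ∈ K) :
    ∃ k, 0 < k ∧ x ^ k ∈ K ∧ y ^ k ∈ K ∧ z ^ k ∈ K := by
  obtain ⟨l, hl, hlx⟩ := hx
  refine ⟨l * n * m, by positivity, ?_, ?_, ?_⟩
  · rw [mul_assoc, pow_mul]; exact pow_mem hlx _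
  · rw [mul_right_comm, mul_comm, pow_mul]; exact pow_mem hy _
  · rw [mul_comm, pow_mul]; exact pow_mem hz _

theorem exists_pow_commute_of_notMem (hN : N.Normal) (hrad : ∀ x ∈ N, IsRadicalOver K (x : D))
    {u : Dˣ} (hu : u ∈ N) {a : D} (ha : a ∉ K) : ∃ n, 0 < n ∧ Commute ((u : D) ^ n) a := by
  have ha0 : a ≠ 0 := fun h ↦ ha (h ▸ K.zero_mem)
  have ha1 : a + 1 ≠ 0 := fun h ↦ ha (by
    rw [eq_neg_of_add_eq_zero_left h]; exact neg_mem K.one_mem)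
  obtain ⟨n, hn, h1⟩ := hrad _ (hN.conj_mem u hu (Units.mk0 a ha0))
  obtain ⟨m, hm, h2⟩ := hrad _ (hN.conj_mem u hu (Units.mk0 (a + 1) ha1))
  obtain ⟨k, hk, hu, h1, h2⟩ := (hrad u hu).exists_common hn h1 hm h2
  refine ⟨k, hk, ?_⟩
  rw [← Units.val_pow_eq_pow_val, conj_pow] at h1 h2
  simp only [Units.val_mul, Units.val_pow_eq_pow_val, Units.val_inv_eq_inv_val,
    Units.val_mk0] at h1 h2
  set c := (u : D) ^ k
  set k₁ := a * c * a⁻¹ with hk₁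
  set k₂ := (a + 1) * c * (a + 1)⁻¹ with hk₂
  have e1 : k₁ * a = a * c := by rw [hk₁, inv_mul_cancel_right₀ ha0]
  have e2 : k₂ * (a + 1) = (a + 1) * c := by rw [hk₂, inv_mul_cancel_right₀ ha1]
  -- If k₂ ≠ k₁, this equation solves for a inside K.
  have e3 : (k₂ - k₁) * a = c - k₂ := by
    rw [sub_mul, e1, ← add_sub_cancel_right (k₂ * a) k₂, ← mul_add_one, e2]
    noncomm_ring
  have e4 : k₂ = k₁ := by
    by_contra hne
    have hne' := sub_ne_zero.2 hne
    apply ha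
    rw [← inv_mul_cancel_left₀ hne' a, e3]
    exact mul_mem (inv_mem (sub_mem h2 h1)) (sub_mem hu h2)
  rw [e4, sub_self, zero_mul] at e3
  rw [← sub_eq_zero.1 e3.symm] at e1
  exact e1

theorem exists_pow_commute (hK : K ≠ ⊤) (hN : N.Normal)
    (hrad : ∀ x ∈ N, IsRadicalOver K (x : D)) {u : Dˣ} (hu : u ∈ N) (d : D) :
    ∃ n, 0 < n ∧ Commute ((u : D) ^ n) d := by
  by_cases hd : d ∈ K
  · obtain ⟨a, ha⟩ : ∃ a, a ∉ K := by
      by_contra! h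
      exact hK (eq_top_iff.2 fun a _ ↦ h a)
    obtain ⟨n, hn, h1⟩ := exists_pow_commute_of_notMem hN hrad hu ha
    -- For d in K, write d = (a + d) - a with both terms outside K.
    obtain ⟨m, hm, h2⟩ := exists_pow_commute_of_notMem hN hrad hu
      (fun h : a + d ∈ K ↦ ha (by simpa using sub_mem h hd))
    refine ⟨n * m, Nat.mul_pos hn hm, ?_⟩
    have h3 : Commute ((u : D) ^ (n * m)) a := by rw [pow_mul]; exact h1.pow_left m
    have h4 : Commute ((u : D) ^ (n * m)) (a + d) := by
      rw [mul_comm, pow_mul]; exact h2.pow_left n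
    simpa using h4.sub_right h3
  · exact exists_pow_commute_of_notMem hN hrad hu hd

theorem exists_pow_mem_center (hD : IsCentrallyFinite D) (hK : K ≠ ⊤) (hN : N.Normal)
    (hrad : ∀ x ∈ N, IsRadicalOver K (x : D)) {u : Dˣ} (hu : u ∈ N) :
    ∃ n, 0 < n ∧ (u : D) ^ n ∈ Subring.center D := by
  have : FiniteDimensional (Subring.center D) D := hD
  let b := Module.finBasis (Subring.center D) D
  choose n hn hc using fun i ↦ exists_pow_commute hK hN hrad hu (b i)
  refine ⟨∏ i, n i, Finset.prod_pos fun i _ ↦ hn i, Subring.mem_center_iff.2 fun d ↦ ?_⟩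
  have hb (i) : Commute ((u : D) ^ ∏ i, n i) (b i) := by
    obtain ⟨m, hm⟩ := Finset.dvd_prod_of_mem n (Finset.mem_univ i)
    rw [hm, pow_mul]
    exact (hc i).pow_left m
  rw [← b.sum_repr d]
  refine Commute.eq (Commute.sum_left _ _ _ fun i _ ↦ ?_)
  exact ((hb i).symm.smul_left _)

theorem commute_of_isCentrallyFinite (hD : IsCentrallyFinite D) (hK : K ≠ ⊤) (hN : N.Normal)
    (hrad : ∀ x ∈ N, IsRadicalOver K (x : D)) {u : Dˣ} (hu : u ∈ N) (d : D) :
    Commute (u : D) d := by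
  have : FiniteDimensional (Subring.center D) D := hD
  refine commute_of_commutators_torsion (F := Subring.center D) u.ne_zero (fun y hy ↦ ?_) d
  have hmem : u * Units.mk0 y hy * u⁻¹ * (Units.mk0 y hy)⁻¹ ∈ N := by
    rw [mul_assoc, mul_assoc, ← mul_assoc (Units.mk0 y hy)]
    exact N.mul_mem hu (hN.conj_mem _ (N.inv_mem hu) _)
  obtain ⟨n, hn, h⟩ := exists_pow_mem_center hD hK hN hrad hmem
  simp only [Units.val_mul, Units.val_inv_eq_inv_val, Units.val_mk0] at h
  exact commutator_pow_eq_one (F := Subring.center D) u.ne_zero hy hn (f := ⟨_, h⟩) rfl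

end Radical

theorem theorem3p5 {D : Type*} [DivisionRing D] (hD : IsWeaklyLocallyFinite D)
    (K : Subfield D) (hK : K ≠ ⊤) (N : Subgroup Dˣ) (hN : N.Normal)
    (hrad : ∀ x ∈ N, IsRadicalOver K (x : D)) :
    ∀ x ∈ N, (x : D) ∈ Subring.center D := by
  intro x hx
  refine Subring.mem_center_iff.2 fun y ↦ ?_
  obtain ⟨a, ha⟩ : ∃ a, a ∉ K := by
    by_contra! h
    exact hK (eq_top_iff.2 fun a _ ↦ h a)
  -- Including a keeps the restriction of K to E proper.
  let S : Set D := {(x : D), y, a}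
  let E := Subfield.closure S
  have hxE : (x : D) ∈ E := Subfield.subset_closure (by simp [S])
  have hyE : y ∈ E := Subfield.subset_closure (by simp [S])
  have haE : a ∈ E := Subfield.subset_closure (by simp [S])
  let K' : Subfield E := K.comap E.subtype
  let N' : Subgroup Eˣ := N.comap (Units.map (E.subtype : E →* D))
  have hK' : K' ≠ ⊤ := fun h ↦ ha (by
    have : (⟨a, haE⟩ : E) ∈ K' := by rw [h]; exact Subfield.mem_top _
    exact this)
  have hrad' : ∀ v ∈ N', IsRadicalOver K' (v : E) := by
    intro v hv
    obtain ⟨n, hn, h⟩ := hrad _ hv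
    exact ⟨n, hn, h⟩
  have hx0 : (⟨x, hxE⟩ : E) ≠ 0 := fun h ↦ x.ne_zero (congrArg Subtype.val h)
  have hxN : Units.mk0 (⟨x, hxE⟩ : E) hx0 ∈ N' := by
    have : Units.map (E.subtype : E →* D) (Units.mk0 (⟨x, hxE⟩ : E) hx0) = x := Units.ext rfl
    rw [Subgroup.mem_comap, this]
    exact hx
  have := commute_of_isCentrallyFinite (hD S (by simp [S])) hK' (hN.comap _) hrad' hxN ⟨y, hyE⟩
  exact (congrArg Subtype.val this.eq).symm
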